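/- Let $n\ge 1$ be an integer and let $\mathcal O_n$ be the universal unital $C^*$-algebra generated by $n$ isometries $S_1,\dots,S_n$ satisfying $\sum_{i=1}^n S_iS_i^*=I$. For $n\ge 2$ this is the Cuntz algebra; for $n=1$ it is the $C^*$-algebra $C(\mathbb T)$ generated by a universal unitary $S_1$. Let $$\mathcal S_n=\operatorname{span}\{I,\,S_i,\,S_i^*: 1\le i\le n\}\subseteq\mathcal O_n,$$ and let $M_p(\mathcal S_n)^+$ be the set of $p\times p$ matrices with entries in $\mathcal S_n$ that are positive elements of the $C^*$-algebra $M_p(\mathcal O_n)$. Write $M_p=M_p(\mathbb C)$. **Corollary.** For all $A_0,A_1,\dots,A_n\in M_p$, one has $$A_0\otimes I+\sum_{i=1}^nA_i\otimes S_i+\sum_{i=1}^nA_i^*\otimes S_i^*\in M_p(\mathcal S_n)^+$$ if and only if there exists $B\in M_p$ such that $$\begin{pmatrix}A_0&2A_1^*&\cdots&2A_n^*\\2A_1&A_0&&\\\vdots&&\ddots&\\2A_n&&&A_0\end{pmatrix}+\begin{pmatrix}B&&&\\&-B&&\\&&\ddots&\\&&&-B\end{pmatrix}\in M_{n+1}(M_p)^+,$$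 where the blocks that are not displayed are zero and $M_{n+1}(M_p)^+$ is the set of block matrices that are positive semidefinite as $(n+1)p\times(n+1)p$ complex matrices. -/

import Mathlib

open scoped ENNReal Matrix ComplexOrder

noncomputable section

/-- `T 0, …, T (n-1)` are isometries in the unital C⋆-algebra `A` with `∑ i, T i * (T i)⋆ = 1`.
For `n = 1` this says that `T 0` is a unitary. -/
structure IsCuntzFamily {n : ℕ} {A : Type*} [CStarAlgebra A] (T : Fin n → A) : Prop where
  isometry : ∀ i, star (T i) * T i = 1
  sum_range : ∑ i, T i * star (T i) = 1

/-- A (nonzero) unital C⋆-algebra together with `n` isometries satisfying the Cuntz relation. -/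
structure CuntzModel (n : ℕ) where
  carrier : Type
  [cstar : CStarAlgebra carrier]
  [nontriv : Nontrivial carrier]
  T : Fin n → carrier
  isCuntz : IsCuntzFamily T

namespace CuntzModel

instance {n : ℕ} (m : CuntzModel n) : CStarAlgebra m.carrier := m.cstar

instance {n : ℕ} (m : CuntzModel n) : Nontrivial m.carrier := m.nontriv

/-- The C⋆-algebra of all bounded families indexed by all the Cuntz families of length `n`. -/
abbrev BigProduct (n : ℕ) : Type 1 := lp (fun m : CuntzModel n => m.carrier) ∞

instance (n : ℕ) : CStarAlgebra (BigProduct n) where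

theorem norm_T_le {n : ℕ} (m : CuntzModel n) (i : Fin n) : ‖m.T i‖ ≤ 1 := by
  have h : ‖star (m.T i) * m.T i‖ = ‖m.T i‖ * ‖m.T i‖ := CStarRing.norm_star_mul_self
  rw [m.isCuntz.isometry i, CStarRing.norm_one] at h
  nlinarith [norm_nonneg (m.T i)]

/-- The bounded family formed by the `i`-th isometries of all the Cuntz families. -/
def bigGen (n : ℕ) (i : Fin n) : BigProduct n :=
  ⟨fun m => m.T i, memℓp_infty ⟨1, by rintro _ ⟨m, rfl⟩; exact m.norm_T_le i⟩⟩

end CuntzModel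

open CuntzModel in
/-- The norm closed unital ⋆-subalgebra generated by the isometries `bigGen n i`. -/
def cuntzSubalgebra (n : ℕ) : StarSubalgebra ℂ (BigProduct n) :=
  (StarAlgebra.adjoin ℂ (Set.range (bigGen n))).topologicalClosure

instance (n : ℕ) : IsClosed (cuntzSubalgebra n : Set (CuntzModel.BigProduct n)) :=
  StarSubalgebra.isClosed_topologicalClosure _

/-- The universal unital C⋆-algebra generated by `n` isometries `S i` with
`∑ i, S i * (S i)⋆ = 1`: the Cuntz algebra `𝓞ₙ` for `2 ≤ n`, and the C⋆-algebra of a universal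
unitary for `n = 1`. (Every C⋆-algebra generated by finitely many elements is isomorphic to one
in `Type`, so it is enough to take the product over the families in `Type`.) -/
def CuntzAlgebra (n : ℕ) : Type 1 := cuntzSubalgebra n

namespace CuntzAlgebra

instance (n : ℕ) : CStarAlgebra (CuntzAlgebra n) :=
  StarSubalgebra.cstarAlgebra (cuntzSubalgebra n)

/-- The usual order of a C⋆-algebra. -/
instance (n : ℕ) : PartialOrder (CuntzAlgebra n) := CStarAlgebra.spectralOrder _

instance (n : ℕ) : StarOrderedRing (CuntzAlgebra n) := CStarAlgebra.spectralOrderedRing _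

/-- The generating isometries. -/
def S {n : ℕ} (i : Fin n) : CuntzAlgebra n :=
  ⟨CuntzModel.bigGen n i, StarSubalgebra.le_topologicalClosure _
    (StarAlgebra.subset_adjoin ℂ _ ⟨i, rfl⟩)⟩

/-- The inclusion in the product. -/
def incl (n : ℕ) : CuntzAlgebra n →⋆ₐ[ℂ] CuntzModel.BigProduct n := (cuntzSubalgebra n).subtype

/-- The generators satisfy the Cuntz relation. -/
theorem isCuntzFamily_S (n : ℕ) : IsCuntzFamily (S : Fin n → CuntzAlgebra n) := by
  constructor
  · intro i
    apply Subtype.ext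
    apply lp.ext
    funext m
    exact m.isCuntz.isometry i
  · apply Subtype.ext
    apply lp.ext
    funext m
    have h : incl n (∑ i, S i * star (S i) : CuntzAlgebra n)
        = ∑ i, CuntzModel.bigGen n i * star (CuntzModel.bigGen n i) :=
      map_sum (incl n) _ _
    refine (congrArg (fun x : CuntzModel.BigProduct n => x m) h).trans ?_
    rw [lp.coeFn_sum, Finset.sum_apply]
    exact m.isCuntz.sum_range

/-- The inclusion in the product followed by the coordinate projection to `m`. -/
def eval {n : ℕ} (m : CuntzModel n) : CuntzAlgebra n →⋆ₐ[ℂ] m.carrier where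
  toFun x := (x.1 : CuntzModel.BigProduct n) m
  map_one' := rfl
  map_mul' _ _ := rfl
  map_zero' := rfl
  map_add' _ _ := rfl
  commutes' _ := rfl
  map_star' _ := rfl

/-- The universal property. -/
theorem exists_starAlgHom {n : ℕ} {B : Type} [CStarAlgebra B] (T : Fin n → B)
    (hT : IsCuntzFamily T) : ∃ π : CuntzAlgebra n →⋆ₐ[ℂ] B, ∀ i, π (S i) = T i := by
  rcases subsingleton_or_nontrivial B with h | h
  · exact ⟨{ toFun := fun _ => 0
             map_one' := Subsingleton.elim _ _
             map_mul' := fun _ _ => Subsingleton.elim _ _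
             map_zero' := rfl
             map_add' := fun _ _ => Subsingleton.elim _ _
             commutes' := fun _ => Subsingleton.elim _ _
             map_star' := fun _ => Subsingleton.elim _ _ }, fun _ => Subsingleton.elim _ _⟩
  · exact ⟨eval ⟨B, T, hT⟩, fun _ => rfl⟩

/-- The C⋆-algebra is generated by the `S i`. -/
theorem dense_adjoin (n : ℕ) :
    Dense (StarAlgebra.adjoin ℂ (Set.range (S : Fin n → CuntzAlgebra n)) :
      Set (CuntzAlgebra n)) := by
  have hmap : (StarAlgebra.adjoin ℂ (Set.range (S : Fin n → CuntzAlgebra n))).map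
      (incl n) = StarAlgebra.adjoin ℂ (Set.range (CuntzModel.bigGen n)) := by
    rw [StarAlgHom.map_adjoin, ← Set.range_comp]
    rfl
  intro x
  have hind : Topology.IsInducing (incl n) := Topology.IsInducing.subtypeVal
  rw [hind.closure_eq_preimage_closure_image]
  have hx : (x.1 : CuntzModel.BigProduct n) ∈
    closure (StarAlgebra.adjoin ℂ (Set.range (CuntzModel.bigGen n)) : Set _) := x.2
  rw [← hmap] at hx
  exact hx

end CuntzAlgebra

/-- The cone `M_p(V)⁺` of a subspace `V` of a C⋆-algebra `A`: the `p × p` matrices with entries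
in `V` that are positive elements of the C⋆-algebra `M_p(A)`. -/
def matrixCone {A : Type*} [CStarAlgebra A] [PartialOrder A] [StarOrderedRing A]
    (V : Submodule ℂ A) (p : ℕ) : Set (CStarMatrix (Fin p) (Fin p) A) :=
  {X | (∀ a b, X a b ∈ V) ∧ 0 ≤ X}

/-- The operator system `𝓢ₙ = span {I, Sᵢ, Sᵢ⋆}` inside the Cuntz algebra. -/
def cuntzSystem (n : ℕ) : Submodule ℂ (CuntzAlgebra n) :=
  Submodule.span ℂ ({1} ∪ Set.range (fun i : Fin n => CuntzAlgebra.S i) ∪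
    Set.range (fun i : Fin n => star (CuntzAlgebra.S i)))

/-- `A ⊗ s`, the matrix with entries `A a b • s`. -/
def matTensor {p : ℕ} {𝓐 : Type*} [SMul ℂ 𝓐] (A : Matrix (Fin p) (Fin p) ℂ) (s : 𝓐) :
    CStarMatrix (Fin p) (Fin p) 𝓐 :=
  CStarMatrix.ofMatrix (Matrix.of fun a b => A a b • s)

/-- The block matrix with `A₀` in every diagonal block, `2 Aⱼᴴ` in the `j`-th block of the first
row, `2 Aᵢ` in the `i`-th block of the first column, and zero elsewhere. -/
def arrowMatrix {n p : ℕ} (A₀ : Matrix (Fin p) (Fin p) ℂ)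
    (A : Fin n → Matrix (Fin p) (Fin p) ℂ) :
    Matrix (Fin (n + 1)) (Fin (n + 1)) (Matrix (Fin p) (Fin p) ℂ) :=
  Matrix.of fun r c => Fin.cases (Fin.cases A₀ (fun j => (2 : ℂ) • (A j)ᴴ) c)
    (fun i => Fin.cases ((2 : ℂ) • A i) (fun j => if i = j then A₀ else 0) c) r

/-- The block diagonal matrix with diagonal blocks `B, -B, …, -B`. -/
def signedDiagonal (n : ℕ) {p : ℕ} (B : Matrix (Fin p) (Fin p) ℂ) :
    Matrix (Fin (n + 1)) (Fin (n + 1)) (Matrix (Fin p) (Fin p) ℂ) :=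
  Matrix.diagonal fun r => Fin.cases B (fun _ => -B) r

/-- `M ∈ M_k(M_p)⁺`: the block matrix `M`, read as a `kp × kp` complex matrix, is positive
semidefinite. -/
def BlockPosSemidef {k p : ℕ} (M : Matrix (Fin k) (Fin k) (Matrix (Fin p) (Fin p) ℂ)) : Prop :=
  (Matrix.comp (Fin k) (Fin k) (Fin p) (Fin p) ℂ M).PosSemidef

end

/-! Compress half of the block matrix by the column `(1, S₁⋆, …, Sₙ⋆)`. The diagonal blocks
contribute `(A₀ + B)/2 ⊗ 1` and `(A₀ - B)/2 ⊗ ∑ Sᵢ Sᵢ⋆`, so the Cuntz relation cancels `B` and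
leaves the pencil. This gives sufficiency of `B`.

For necessity, suppose no `B` works. Conic duality (`Matrix.exists_posSemidef_sum_mul_lt_zero`)
gives `Y ≥ 0` that annihilates every `diag(B, -B, …, -B)` and pairs negatively with the arrow
matrix. Annihilation means `Y₀₀ = ∑ Yᵢᵢ` blockwise. Write `Y` as a Gram matrix of vectors `z r a` in
`ℓ²`; then the `z₀ a` and the tuples `(zᵢ a)ᵢ` in `(ℓ²)ⁿ` have equal Gram matrices. Both spaces are
separable and infinite dimensional, so a unitary `ℓ² → (ℓ²)ⁿ` carries one family to the other, and
its coordinates are the adjoints of a Cuntz family. In the resulting representation of the universal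
algebra, the form of the pencil at the `z₀ a` is half the negative pairing, which contradicts
positivity. -/

section HilbertSpace

/-! ### Extending equality of Gram matrices to a unitary. -/

variable {E F : Type*} [NormedAddCommGroup E] [InnerProductSpace ℂ E]
  [NormedAddCommGroup F] [InnerProductSpace ℂ F]

/-- An orthonormal family in a separable inner product space is countable. -/
theorem Orthonormal.countable_index [TopologicalSpace.SeparableSpace E] {ι : Type*} {v : ι → E}
    (hv : Orthonormal ℂ v) : Countable ι := by
  have hd : DiscreteTopology (Set.range v) := by
    refine DiscreteTopology.of_forall_le_dist (r := 1) one_pos ?_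
    rintro ⟨_, i, rfl⟩ ⟨_, j, rfl⟩ hij
    have hne : i ≠ j := fun h => hij (by subst h; rfl)
    have h := norm_sub_sq (𝕜 := ℂ) (v i) (v j)
    rw [hv.2 hne, hv.1 i, hv.1 j] at h
    rw [Subtype.dist_eq, dist_eq_norm]
    simp only [map_zero, mul_zero, sub_zero, one_pow] at h
    nlinarith [norm_nonneg (v i - v j)]
  have hc : Countable (Set.range v) :=
    TopologicalSpace.separableSpace_iff_countable.mp inferInstance
  exact (Set.rangeFactorization_injective.mpr hv.linearIndependent.injective).countable

/-- A finite orthonormal family in an infinite dimensional separable Hilbert space extends to a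
Hilbert basis with countably many further members. -/
theorem Orthonormal.exists_hilbertBasis_sum_nat [CompleteSpace E]
    [TopologicalSpace.SeparableSpace E]
    (hE : ¬ FiniteDimensional ℂ E) {ι : Type*} [Finite ι] {u : ι → E} (hu : Orthonormal ℂ u) :
    ∃ b : HilbertBasis (ι ⊕ ℕ) ℂ E, ∀ i, b (Sum.inl i) = u i := by
  classical
  obtain ⟨w, b, hsw, hb⟩ := hu.toSubtypeRange.exists_hilbertBasis_extension
  have hw : Orthonormal ℂ ((↑) : w → E) := hb ▸ b.orthonormal
  have hwc : Countable w := hw.countable_index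
  have hwi : w.Infinite := by
    intro hfin
    have : Fintype w := hfin.fintype
    exact hE (Module.Finite.of_basis b.toOrthonormalBasis.toBasis)
  have hdi : Infinite ↥(w \ Set.range u) := (hwi.sdiff (Set.finite_range u)).to_subtype
  have hdc : Countable ↥(w \ Set.range u) :=
    ((Set.countable_coe_iff.mp hwc).mono Set.sdiff_subset).to_subtype
  obtain ⟨hden⟩ := nonempty_denumerable ↥(w \ Set.range u)
  let g : ℕ ≃ ↥(w \ Set.range u) := (Denumerable.eqv _).symm
  let e : ι ⊕ ℕ → w :=
    Sum.elim (fun i => ⟨u i, hsw ⟨i, rfl⟩⟩) (fun k => ⟨g k, (g k).2.1⟩)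
  have he : Function.Injective e := by
    rintro (i | k) (j | l) h
    · exact congrArg _ (hu.linearIndependent.injective (congrArg Subtype.val h))
    · exact absurd ⟨i, congrArg Subtype.val h⟩ (g l).2.2
    · exact absurd ⟨j, (congrArg Subtype.val h).symm⟩ (g k).2.2
    · exact congrArg _ (g.injective (Subtype.ext (Subtype.mk.inj h)))
  have hes : Function.Surjective e := by
    rintro ⟨x, hx⟩
    by_cases h : x ∈ Set.range u
    · obtain ⟨i, rfl⟩ := h
      exact ⟨Sum.inl i, rfl⟩
    · exact ⟨Sum.inr (g.symm ⟨x, hx, h⟩), by simp [e]⟩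
  have hor : Orthonormal ℂ (((↑) : w → E) ∘ e) := hw.comp e he
  refine ⟨HilbertBasis.mk hor ?_, fun i => ?_⟩
  · rw [hes.range_comp, ← hb]
    exact b.dense_span.ge
  · rw [HilbertBasis.coe_mk]
    rfl

/-- Two finite families of vectors with the same Gram matrix, in infinite dimensional separable
Hilbert spaces, are carried to each other by a unitary. -/
theorem exists_linearIsometryEquiv_of_inner_eq [CompleteSpace E]
    [TopologicalSpace.SeparableSpace E] [CompleteSpace F]
    [TopologicalSpace.SeparableSpace F] (hE : ¬ FiniteDimensional ℂ E)
    (hF : ¬ FiniteDimensional ℂ F) {ι : Type*} [Fintype ι] (v : ι → E) (w : ι → F)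
    (h : ∀ i j, inner ℂ (v i) (v j) = inner ℂ (w i) (w j)) :
    ∃ U : E ≃ₗᵢ[ℂ] F, ∀ i, U (v i) = w i := by
  classical
  let Tv : (ι → ℂ) →ₗ[ℂ] E := Fintype.linearCombination ℂ v
  let Tw : (ι → ℂ) →ₗ[ℂ] F := Fintype.linearCombination ℂ w
  have hT : ∀ x y, inner ℂ (Tv x) (Tv y) = inner ℂ (Tw x) (Tw y) := by
    intro x y
    simp only [Tv, Tw, Fintype.linearCombination_apply, sum_inner, inner_sum, inner_smul_left,
      inner_smul_right, h]
  have hker : ∀ x, Tv x = 0 → Tw x = 0 := by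
    intro x hx
    rw [← inner_self_eq_zero (𝕜 := ℂ), ← hT, hx, inner_zero_left]
  let b := stdOrthonormalBasis ℂ (LinearMap.range Tv)
  choose x hx using fun j => (b j).2
  have hor : Orthonormal ℂ (fun j => (b j : E)) :=
    b.orthonormal.comp_linearIsometry (LinearMap.range Tv).subtypeₗᵢ
  have hor' : Orthonormal ℂ (fun j => Tw (x j)) := by
    rw [orthonormal_iff_ite] at hor ⊢
    intro i j
    rw [← hT, hx, hx]
    exact hor i j
  -- The two orthonormal families share an index type, and both extensions add a copy of `ℕ`;
  -- identifying coordinates therefore gives a unitary of the whole spaces.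
  obtain ⟨c, hc⟩ := hor.exists_hilbertBasis_sum_nat hE
  obtain ⟨d, hd⟩ := hor'.exists_hilbertBasis_sum_nat hF
  let U : E ≃ₗᵢ[ℂ] F := c.repr.trans d.repr.symm
  have hU : ∀ j, U (b j) = Tw (x j) := by
    intro j
    rw [← hc, ← hd]
    change d.repr.symm (c.repr (c (Sum.inl j))) = _
    rw [c.repr_self, d.repr_symm_single]
  refine ⟨U, fun i => ?_⟩
  let m : LinearMap.range Tv := ⟨v i, Pi.single i 1, by simp [Tv]⟩
  have hm : (v i : E) = ∑ j, b.repr m j • (b j : E) := by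
    have := congrArg Subtype.val (b.sum_repr m)
    simpa [m] using this.symm
  -- Linear relations among the `v i` also hold among the `w i`, since equal Gram matrices force
  -- `ker Tv ≤ ker Tw`.
  have hz : Tv (Pi.single i 1 - ∑ j, b.repr m j • x j) = 0 := by
    rw [map_sub, map_sum]
    simp only [map_smul, hx]
    rw [← hm]
    simp [Tv]
  have hz' := hker _ hz
  rw [map_sub, map_sum, sub_eq_zero] at hz'
  calc U (v i) = ∑ j, b.repr m j • U (b j) := by rw [hm, map_sum]; simp only [map_smul]
    _ = ∑ j, Tw (b.repr m j • x j) := by simp only [hU, map_smul]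
    _ = w i := by rw [← hz']; simp [Tw]

theorem HilbertBasis.not_finiteDimensional {ι : Type*} [Infinite ι] (b : HilbertBasis ι ℂ E) :
    ¬ FiniteDimensional ℂ E := by
  intro h
  exact not_finite_iff_infinite.mpr ‹_› b.orthonormal.linearIndependent.finite

theorem HilbertBasis.separableSpace {ι : Type*} [Countable ι] (b : HilbertBasis ι ℂ E) :
    TopologicalSpace.SeparableSpace E := by
  rw [← TopologicalSpace.isSeparable_univ_iff]
  have h := ((Set.countable_range b).isSeparable.span (R := ℂ)).closure
  have h2 : closure (Submodule.span ℂ (Set.range b) : Set E) = Set.univ := by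
    rw [← Submodule.topologicalClosure_coe, b.dense_span, Submodule.top_coe]
  rwa [h2] at h

/-- The standard infinite dimensional separable Hilbert space. -/
abbrev EllTwo : Type := lp (fun _ : ℕ => ℂ) 2

theorem EllTwo.hilbertBasis : Nonempty (HilbertBasis ℕ ℂ EllTwo) :=
  ⟨⟨LinearIsometryEquiv.refl ℂ _⟩⟩

instance : TopologicalSpace.SeparableSpace EllTwo :=
  EllTwo.hilbertBasis.some.separableSpace

theorem EllTwo.not_finiteDimensional : ¬ FiniteDimensional ℂ EllTwo :=
  EllTwo.hilbertBasis.some.not_finiteDimensional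

end HilbertSpace

/-! ### Cuntz families from unitaries `H → Hⁿ`. -/

section CuntzFamily

variable {n : ℕ}

/-- The Cuntz family whose adjoints are the coordinates of a unitary `U : H → Hⁿ`. -/
theorem exists_isCuntzFamily_adjoint_apply {H : Type*} [NormedAddCommGroup H]
    [InnerProductSpace ℂ H] [CompleteSpace H] (U : H ≃ₗᵢ[ℂ] PiLp 2 (fun _ : Fin n => H)) :
    ∃ T : Fin n → (H →L[ℂ] H), IsCuntzFamily T ∧
      ∀ i x, (star (T i)) x = U x i := by
  classical
  let V : Fin n → (H →L[ℂ] H) := fun i =>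
    (PiLp.proj 2 (fun _ : Fin n => H) i : _ →L[ℂ] H) ∘L (U : H →L[ℂ] _)
  have hV : ∀ i x, V i x = U x i := fun i x => rfl
  have hadj : ∀ i y, star (V i) y = U.symm (PiLp.single 2 i y) := by
    intro i y
    refine ext_inner_left ℂ fun x => ?_
    rw [ContinuousLinearMap.star_eq_adjoint, ContinuousLinearMap.adjoint_inner_right, hV,
      ← U.inner_map_map x, U.apply_symm_apply, PiLp.inner_apply,
      Finset.sum_eq_single i (fun j _ hj => by simp [hj]) (by simp)]
    simp
  -- The isometry relation is `U U⁻¹ = 1` read in coordinate `i`; the sum relation says that `U`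
  -- preserves inner products.
  refine ⟨fun i => star (V i), ⟨fun i => ?_, ?_⟩, fun i x => ?_⟩
  · ext x
    simp [hadj, hV]
  · ext x
    refine ext_inner_left ℂ fun y => ?_
    simp only [star_star, sum_apply, inner_sum, mul_apply_eq_comp,
      one_apply_eq_self]
    simp only [ContinuousLinearMap.star_eq_adjoint, ContinuousLinearMap.adjoint_inner_right, hV]
    rw [← PiLp.inner_apply, U.inner_map_map]
  · rw [star_star, hV]

/-- If `z r a` are vectors with `⟪z₀ a, z₀ b⟫ = ∑ i, ⟪zᵢ a, zᵢ b⟫`, then some Cuntz family on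
`ℓ²` maps, through adjoints, copies of the `z₀ a` to copies of the `zᵢ a`. -/
theorem exists_isCuntzFamily_of_inner (hn : 1 ≤ n) {α : Type*} [Fintype α]
    (x : α → EllTwo) (z : Fin n → α → EllTwo)
    (h : ∀ a b, inner ℂ (x a) (x b) = ∑ i, inner ℂ (z i a) (z i b)) :
    ∃ T : Fin n → (EllTwo →L[ℂ] EllTwo), IsCuntzFamily T ∧
      ∀ i a, (star (T i)) (x a) = z i a := by
  classical
  have hF : ¬ FiniteDimensional ℂ (PiLp 2 (fun _ : Fin n => EllTwo)) := by
    intro hfin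
    refine EllTwo.not_finiteDimensional ?_
    refine FiniteDimensional.of_surjective
      (PiLp.proj 2 (fun _ : Fin n => EllTwo) ⟨0, hn⟩ : _ →L[ℂ] EllTwo).toLinearMap fun y => ?_
    exact ⟨PiLp.single 2 ⟨0, hn⟩ y, by simp⟩
  have : SecondCountableTopology EllTwo := UniformSpace.secondCountable_of_separable _
  obtain ⟨U, hU⟩ := exists_linearIsometryEquiv_of_inner_eq EllTwo.not_finiteDimensional hF x
    (fun a => WithLp.toLp 2 (fun i => z i a)) (fun a b => by rw [h, PiLp.inner_apply])
  obtain ⟨T, hT, hTU⟩ := exists_isCuntzFamily_adjoint_apply U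
  exact ⟨T, hT, fun i a => by rw [hTU, hU]⟩

end CuntzFamily

/-! ### Conic duality for positive semidefinite matrices. -/

section PosSemidefDuality

open Filter Topology

/-- The principal minor on `r, c` gives `‖P r c‖² ≤ P r r * P c c`. Bounded diagonals thus bound all
entries, which supplies compactness below. -/
theorem Matrix.PosSemidef.norm_apply_le_of_diag_le {m : Type*} {P : Matrix m m ℂ} (hP : P.PosSemidef)
    {R : ℝ} (hR : ∀ r, (P r r).re ≤ R) (r c : m) : ‖P r c‖ ≤ R := by
  classical
  have hd : ∀ r, 0 ≤ P r r := fun r => hP.diag_nonneg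
  have hre : ∀ r, P r r = ((P r r).re : ℂ) := fun r =>
    Complex.ext rfl (Complex.nonneg_iff.mp (hd r)).2.symm
  have h := (hP.submatrix ![r, c]).det_nonneg
  have hcr : P c r = star (P r c) := (hP.1.apply c r).symm
  rw [Matrix.det_fin_two] at h
  simp only [Matrix.submatrix_apply, Matrix.cons_val_zero, Matrix.cons_val_one] at h
  rw [hcr, hre r, hre c, Complex.star_def, Complex.mul_conj, Complex.normSq_eq_norm_sq] at h
  have h' : 0 ≤ (P r r).re * (P c c).re - ‖P r c‖ ^ 2 := by exact_mod_cast h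
  have h0 := (Complex.nonneg_iff.mp (hd r)).1
  have h1 := (Complex.nonneg_iff.mp (hd c)).1
  have h2 : (P r r).re * (P c c).re ≤ R * R :=
    mul_le_mul (hR r) (hR c) h1 (h0.trans (hR r))
  exact abs_le_of_sq_le_sq' (by nlinarith) (h0.trans (hR r)) |>.2

variable {m : Type*} [Fintype m]

theorem Matrix.isClosed_setOf_posSemidef : IsClosed {P : Matrix m m ℂ | P.PosSemidef} := by
  simp only [Matrix.posSemidef_iff_dotProduct_mulVec, Set.ofPred_and, Set.ofPred_forall]
  refine IsClosed.inter ?_ (isClosed_iInter fun x => ?_)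
  · exact isClosed_eq (by fun_prop) continuous_id
  · exact isClosed_le continuous_const (by fun_prop)

/-- The sum of the cone of positive semidefinite matrices and a subspace on which some strictly
positive weighted trace vanishes is closed. -/
theorem Matrix.isClosed_setOf_exists_add_posSemidef (N : Submodule ℂ (Matrix m m ℂ))
    (l : m → ℝ) (hl : ∀ r, 0 < l r) (hN : ∀ X ∈ N, ∑ r, (l r : ℂ) * X r r = 0) :
    IsClosed {M : Matrix m m ℂ | ∃ X ∈ N, (M + X).PosSemidef} := by
  have : FirstCountableTopology (Matrix m m ℂ) :=
    inferInstanceAs (FirstCountableTopology (m → m → ℂ))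
  refine IsSeqClosed.isClosed fun M M₀ hM hlim => ?_
  choose X hXN hX using hM
  have hent : ∀ r c, Tendsto (fun k => M k r c) atTop (𝓝 (M₀ r c)) := fun r c =>
    ((continuous_id.matrix_elem r c).tendsto M₀).comp hlim
  -- The weighted trace of `M k + X k` equals that of the convergent `M k`, so it is bounded;
  -- positivity then bounds each diagonal entry.
  have htr : Tendsto (fun k => ∑ r, l r * (M k r r).re) atTop (𝓝 (∑ r, l r * (M₀ r r).re)) :=
    tendsto_finsetSum _ fun r _ =>
      ((Complex.continuous_re.tendsto _).comp (hent r r)).const_mul _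
  obtain ⟨R, hR⟩ := htr.bddAbove_range
  have hR' : ∀ k, ∑ r, l r * (M k r r).re ≤ R := fun k => hR ⟨k, rfl⟩
  have hsum : ∀ k, ∑ r, l r * ((M k + X k) r r).re = ∑ r, l r * (M k r r).re := by
    intro k
    have h := congrArg Complex.re (hN (X k) (hXN k))
    simp only [Complex.re_sum, Complex.re_ofReal_mul, Complex.zero_re] at h
    simp only [Matrix.add_apply, Complex.add_re, mul_add, Finset.sum_add_distrib, h, add_zero]
  have hdiag : ∀ k r, 0 ≤ ((M k + X k) r r).re := fun k r =>
    (Complex.nonneg_iff.mp (hX k).diag_nonneg).1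
  have hbd : ∀ k r, ((M k + X k) r r).re ≤ ∑ s, R / l s := by
    intro k r
    have h0 : 0 ≤ R := (Finset.sum_nonneg fun r _ => mul_nonneg (hl r).le (hdiag k r)).trans
      ((hsum k).trans_le (hR' k))
    have h1 : l r * ((M k + X k) r r).re ≤ R :=
      (Finset.single_le_sum (f := fun r => l r * ((M k + X k) r r).re)
        (fun r _ => mul_nonneg (hl r).le (hdiag k r)) (Finset.mem_univ r)).trans
        ((hsum k).trans_le (hR' k))
    calc ((M k + X k) r r).re ≤ R / l r := by rwa [le_div_iff₀' (hl r)]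
      _ ≤ _ := Finset.single_le_sum (f := fun s => R / l s)
        (fun s _ => div_nonneg h0 (hl s).le) (Finset.mem_univ r)
  have hK : IsCompact {P : Matrix m m ℂ | ∀ r c, P r c ∈ Metric.closedBall 0 (∑ s, R / l s)} := by
    have h : IsCompact (Set.univ.pi fun _ : m => Set.univ.pi fun _ : m =>
        Metric.closedBall (0 : ℂ) (∑ s, R / l s)) :=
      isCompact_univ_pi fun _ => isCompact_univ_pi fun _ => isCompact_closedBall _ _
    have hset : (Set.univ.pi fun _ : m => Set.univ.pi fun _ : m =>
        Metric.closedBall (0 : ℂ) (∑ s, R / l s)) =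
        {P | ∀ r c, P r c ∈ Metric.closedBall 0 (∑ s, R / l s)} := by
      ext P
      simp only [Set.mem_pi, Set.mem_univ, true_imp_iff, Set.mem_ofPred_eq]
    rw [hset] at h
    exact h
  obtain ⟨P, -, φ, hφ, hP'⟩ := hK.tendsto_subseq (x := fun k => M k + X k) fun k r c => by
    rw [mem_closedBall_zero_iff]
    exact (hX k).norm_apply_le_of_diag_le (hbd k) r c
  have hPpos : Matrix.PosSemidef P :=
    Matrix.isClosed_setOf_posSemidef.mem_of_tendsto hP' (Eventually.of_forall fun k => hX _)
  have hNc : IsClosed (N : Set (Matrix m m ℂ)) := Submodule.closed_of_finiteDimensional N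
  have hlim2 : Tendsto (fun k => X (φ k)) atTop (𝓝 (P - M₀)) := by
    have := hP'.sub (hlim.comp hφ.tendsto_atTop)
    simpa using this
  refine ⟨P - M₀,
    hNc.mem_of_tendsto hlim2 (Eventually.of_forall fun k => hXN _), ?_⟩
  rwa [add_sub_cancel]

/-- Conic duality for the problem of making a Hermitian matrix positive semidefinite by adding
an element of a self-adjoint subspace. -/
theorem Matrix.exists_posSemidef_sum_mul_lt_zero (N : Submodule ℂ (Matrix m m ℂ))
    (hNstar : ∀ X ∈ N, Xᴴ ∈ N)
    (l : m → ℝ) (hl : ∀ r, 0 < l r) (hN : ∀ X ∈ N, ∑ r, (l r : ℂ) * X r r = 0)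
    {M : Matrix m m ℂ} (hM : M.IsHermitian) (hMN : ¬ ∃ X ∈ N, (M + X).PosSemidef) :
    ∃ Y : Matrix m m ℂ, Y.PosSemidef ∧ (∀ X ∈ N, ∑ r, ∑ c, X r c * Y r c = 0) ∧
      (∑ r, ∑ c, M r c * Y r c).re < 0 := by
  classical
  have : LocallyConvexSpace ℝ (Matrix m m ℂ) :=
    inferInstanceAs (LocallyConvexSpace ℝ (m → m → ℂ))
  let C : Set (Matrix m m ℂ) := {M | ∃ X ∈ N, (M + X).PosSemidef}
  have hCadd : ∀ P ∈ C, ∀ Q ∈ C, P + Q ∈ C := by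
    rintro P ⟨X, hX, hPX⟩ Q ⟨Z, hZ, hQZ⟩
    exact ⟨X + Z, N.add_mem hX hZ, by rw [add_add_add_comm]; exact hPX.add hQZ⟩
  have hCsmul : ∀ t : ℝ, 0 ≤ t → ∀ P ∈ C, t • P ∈ C := by
    rintro t ht P ⟨X, hX, hPX⟩
    refine ⟨t • X, N.smul_of_tower_mem t hX, ?_⟩
    rw [← smul_add]
    exact hPX.smul ht
  have hCconv : Convex ℝ C := fun P hP Q hQ s t hs ht _ =>
    hCadd _ (hCsmul s hs P hP) _ (hCsmul t ht Q hQ)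
  obtain ⟨f, u, hfu, huM⟩ := geometric_hahn_banach_closed_point hCconv
    (Matrix.isClosed_setOf_exists_add_posSemidef N l hl hN) hMN
  have h0C : (0 : Matrix m m ℂ) ∈ C := ⟨0, N.zero_mem, by simpa using Matrix.PosSemidef.zero⟩
  have hu : 0 < u := by simpa using hfu 0 h0C
  have hfC : ∀ P ∈ C, f P ≤ 0 := by
    intro P hP
    by_contra! hpos
    -- This scaling makes `f` equal to `u` at a point of the cone, where it must be less than `u`.
    have h := hfu _ (hCsmul (u / f P) (div_pos hu hpos).le P hP)
    rw [map_smul, smul_eq_mul, div_mul_cancel₀ _ hpos.ne'] at h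
    exact lt_irrefl _ h
  let F : Matrix m m ℂ →ₗ[ℂ] ℂ := Module.Dual.extendRCLike (𝕜 := ℂ) (-f.toLinearMap)
  have hFre : ∀ P, (F P).re = -f P := fun P =>
    Module.Dual.re_extendRCLike_apply (𝕜 := ℂ) (-f.toLinearMap) P
  have hFN : ∀ X ∈ N, F X = 0 := by
    have key : ∀ X ∈ N, f X = 0 := by
      have hXC : ∀ X ∈ N, f X ≤ 0 := fun X hX =>
        hfC X ⟨-X, N.neg_mem hX, by simpa using Matrix.PosSemidef.zero⟩
      intro X hX
      have h2 := hXC (-X) (N.neg_mem hX)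
      rw [map_neg] at h2
      linarith [hXC X hX]
    intro X hX
    apply Complex.ext
    · rw [hFre, key X hX]; simp
    · have h := hFre (Complex.I • X)
      rw [key _ (N.smul_mem _ hX), map_smul, smul_eq_mul, Complex.I_mul_re] at h
      simpa using h
  let W : Matrix m m ℂ := Matrix.of fun r c => F (Matrix.single r c 1)
  have hFW : ∀ P : Matrix m m ℂ, F P = ∑ r, ∑ c, P r c * W r c := by
    intro P
    conv_lhs => rw [Matrix.matrix_eq_sum_single P]
    simp only [map_sum]
    refine Finset.sum_congr rfl fun r _ => Finset.sum_congr rfl fun c _ => ?_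
    rw [show Matrix.single r c (P r c) = P r c • Matrix.single r c (1 : ℂ) by simp, map_smul,
      smul_eq_mul]
    rfl
  -- Only the real part of `F` is controlled. Symmetrizing `W` makes the pairing equal to `2 Re F P`
  -- on Hermitian `P`.
  have hFY : ∀ P : Matrix m m ℂ, ∑ r, ∑ c, P r c * (W + Wᴴ) r c = F P + star (F Pᴴ) := by
    intro P
    simp only [hFW, Matrix.add_apply, mul_add, Finset.sum_add_distrib, star_sum, star_mul',
      Matrix.conjTranspose_apply, star_star]
    rw [Finset.sum_comm (f := fun r c => P r c * star (W c r))]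
  refine ⟨W + Wᴴ, Matrix.PosSemidef.of_dotProduct_mulVec_nonneg ?_ fun x => ?_, fun X hX => ?_, ?_⟩
  · exact Matrix.isHermitian_add_transpose_self W
  -- The pairing `∑ P r c * Y r c` involves no transpose, so the rank-one test matrix has `star x`
  -- on the left.
  · have hP : (Matrix.vecMulVec (star x) x).PosSemidef := by
      simpa using Matrix.posSemidef_vecMulVec_self_star (star x)
    have h := hFY (Matrix.vecMulVec (star x) x)
    rw [hP.1] at h
    have h2 : star x ⬝ᵥ ((W + Wᴴ) *ᵥ x) =
        ∑ r, ∑ c, Matrix.vecMulVec (star x) x r c * (W + Wᴴ) r c := by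
      simp only [dotProduct, Matrix.mulVec, Matrix.vecMulVec_apply, Finset.mul_sum]
      exact Finset.sum_congr rfl fun r _ => Finset.sum_congr rfl fun c _ => by ring
    rw [h2, h, Complex.star_def, Complex.add_conj, hFre]
    have h3 := hfC _ ⟨0, N.zero_mem, by simpa using hP⟩
    exact_mod_cast (by linarith : (0 : ℝ) ≤ 2 * -f (Matrix.vecMulVec (star x) x))
  · rw [hFY, hFN X hX, hFN _ (hNstar X hX)]
    simp
  · rw [hFY, hM, Complex.star_def, Complex.add_conj, hFre, Complex.ofReal_re]
    linarith

end PosSemidefDuality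

/-! ### Gram vectors in `ℓ²`. -/

section GramVectors

/-- A positive semidefinite matrix is the Gram matrix of vectors in `ℓ²`. -/
theorem Matrix.PosSemidef.exists_inner_ellTwo {m : Type*} [Fintype m]
    {Y : Matrix m m ℂ} (hY : Y.PosSemidef) :
    ∃ z : m → EllTwo, ∀ r c, inner ℂ (z r) (z c) = Y r c := by
  classical
  obtain ⟨Z, rfl⟩ : ∃ Z : Matrix m m ℂ, Y = Zᴴ * Z := by
    open scoped MatrixOrder in
    exact CStarAlgebra.nonneg_iff_eq_star_mul_self.mp hY.nonneg
  obtain ⟨b⟩ := EllTwo.hilbertBasis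
  let e : m → EllTwo := fun k => b (Fintype.equivFin m k)
  have he : Orthonormal ℂ e :=
    b.orthonormal.comp _ (Fin.val_injective.comp (Fintype.equivFin m).injective)
  refine ⟨fun r => ∑ k, Z k r • e k, fun r c => ?_⟩
  rw [he.inner_sum]
  rfl

end GramVectors

/-! ### Block matrices and their entrywise pairings. -/

section BlockMatrices

variable {n p : ℕ}

@[simp]
theorem arrowMatrix_zero_zero (A₀ : Matrix (Fin p) (Fin p) ℂ)
    (A : Fin n → Matrix (Fin p) (Fin p) ℂ) : arrowMatrix A₀ A 0 0 = A₀ := rfl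

@[simp]
theorem arrowMatrix_zero_succ (A₀ : Matrix (Fin p) (Fin p) ℂ)
    (A : Fin n → Matrix (Fin p) (Fin p) ℂ) (j : Fin n) :
    arrowMatrix A₀ A 0 j.succ = (2 : ℂ) • (A j)ᴴ := rfl

@[simp]
theorem arrowMatrix_succ_zero (A₀ : Matrix (Fin p) (Fin p) ℂ)
    (A : Fin n → Matrix (Fin p) (Fin p) ℂ) (i : Fin n) :
    arrowMatrix A₀ A i.succ 0 = (2 : ℂ) • A i := rfl

@[simp]
theorem arrowMatrix_succ_succ (A₀ : Matrix (Fin p) (Fin p) ℂ)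
    (A : Fin n → Matrix (Fin p) (Fin p) ℂ) (i j : Fin n) :
    arrowMatrix A₀ A i.succ j.succ = if i = j then A₀ else 0 := rfl

@[simp]
theorem signedDiagonal_zero_zero (B : Matrix (Fin p) (Fin p) ℂ) : signedDiagonal n B 0 0 = B :=
  Matrix.diagonal_apply_eq _ _

@[simp]
theorem signedDiagonal_zero_succ (B : Matrix (Fin p) (Fin p) ℂ) (j : Fin n) :
    signedDiagonal n B 0 j.succ = 0 :=
  Matrix.diagonal_apply_ne _ (Fin.succ_ne_zero j).symm

@[simp]
theorem signedDiagonal_succ_zero (B : Matrix (Fin p) (Fin p) ℂ) (i : Fin n) :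
    signedDiagonal n B i.succ 0 = 0 :=
  Matrix.diagonal_apply_ne _ (Fin.succ_ne_zero i)

@[simp]
theorem signedDiagonal_succ_succ (B : Matrix (Fin p) (Fin p) ℂ) (i j : Fin n) :
    signedDiagonal n B i.succ j.succ = if i = j then -B else 0 := by
  by_cases h : i = j
  · subst h
    rw [if_pos rfl]
    exact Matrix.diagonal_apply_eq _ _
  · rw [if_neg h]
    exact Matrix.diagonal_apply_ne _ (fun h' => h (Fin.succ_injective _ h'))

theorem isHermitian_comp_arrowMatrix {A₀ : Matrix (Fin p) (Fin p) ℂ} (h₀ : A₀.IsHermitian)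
    (A : Fin n → Matrix (Fin p) (Fin p) ℂ) :
    (Matrix.comp _ _ _ _ ℂ (arrowMatrix A₀ A)).IsHermitian := by
  ext ⟨r, a⟩ ⟨s, b⟩
  rw [Matrix.conjTranspose_apply, Matrix.comp_apply, Matrix.comp_apply]
  refine Fin.cases ?_ (fun i => ?_) r <;> refine Fin.cases ?_ (fun j => ?_) s
  · exact h₀.apply a b
  · simp
  · simp
  · by_cases h : i = j
    · simp [h, h₀.apply a b]
    · simp [h, Ne.symm h]

/-- The subspace of the block matrices `diag(B, -B, …, -B)`, read as complex matrices. -/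
def signedDiagonalSubmodule (n p : ℕ) :
    Submodule ℂ (Matrix (Fin (n + 1) × Fin p) (Fin (n + 1) × Fin p) ℂ) where
  carrier := Set.range fun B => Matrix.comp _ _ _ _ ℂ (signedDiagonal n B)
  zero_mem' := by
    refine ⟨0, ?_⟩
    ext ⟨r, a⟩ ⟨s, b⟩
    refine Fin.cases ?_ (fun i => ?_) r <;> refine Fin.cases ?_ (fun j => ?_) s <;> simp
  add_mem' := by
    rintro _ _ ⟨B, rfl⟩ ⟨B', rfl⟩
    refine ⟨B + B', ?_⟩
    ext ⟨r, a⟩ ⟨s, b⟩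
    refine Fin.cases ?_ (fun i => ?_) r <;> refine Fin.cases ?_ (fun j => ?_) s <;> simp
    split_ifs <;> simp [add_comm]
  smul_mem' := by
    rintro t _ ⟨B, rfl⟩
    refine ⟨t • B, ?_⟩
    ext ⟨r, a⟩ ⟨s, b⟩
    refine Fin.cases ?_ (fun i => ?_) r <;> refine Fin.cases ?_ (fun j => ?_) s <;> simp
    split_ifs <;> simp

theorem conjTranspose_comp_signedDiagonal (B : Matrix (Fin p) (Fin p) ℂ) :
    (Matrix.comp _ _ _ _ ℂ (signedDiagonal n B))ᴴ =
      Matrix.comp _ _ _ _ ℂ (signedDiagonal n Bᴴ) := by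
  ext ⟨r, a⟩ ⟨s, b⟩
  rw [Matrix.conjTranspose_apply, Matrix.comp_apply, Matrix.comp_apply]
  refine Fin.cases ?_ (fun i => ?_) r <;> refine Fin.cases ?_ (fun j => ?_) s
  · simp
  · simp
  · simp
  · by_cases h : i = j
    · simp [h]
    · simp [h, Ne.symm h]

theorem signedDiagonal_succ_succ_apply (B : Matrix (Fin p) (Fin p) ℂ) (i j : Fin n)
    (a b : Fin p) : signedDiagonal n B i.succ j.succ a b = if i = j then -B a b else 0 := by
  rw [signedDiagonal_succ_succ]
  split_ifs <;> rfl

theorem arrowMatrix_succ_succ_apply (A₀ : Matrix (Fin p) (Fin p) ℂ)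
    (A : Fin n → Matrix (Fin p) (Fin p) ℂ) (i j : Fin n) (a b : Fin p) :
    arrowMatrix A₀ A i.succ j.succ a b = if i = j then A₀ a b else 0 := by
  rw [arrowMatrix_succ_succ]
  split_ifs <;> rfl

theorem sum_block {R : Type*} [AddCommMonoid R] (g : Fin (n + 1) × Fin p → Fin (n + 1) × Fin p → R) :
    ∑ x, ∑ y, g x y = ∑ a, ∑ b, ((g (0, a) (0, b) + ∑ j : Fin n, g (0, a) (j.succ, b)) +
      ∑ i : Fin n, (g (i.succ, a) (0, b) + ∑ j : Fin n, g (i.succ, a) (j.succ, b))) := by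
  have h : ∑ x, ∑ y, g x y = ∑ a, ∑ b, ∑ r, ∑ s, g (r, a) (s, b) := by
    rw [Fintype.sum_prod_type_right]
    refine Finset.sum_congr rfl fun a _ => ?_
    rw [Finset.sum_comm (f := fun b r => ∑ s, g (r, a) (s, b))]
    exact Finset.sum_congr rfl fun r _ => Fintype.sum_prod_type_right (fun y => g (r, a) y)
  rw [h]
  simp only [Fin.sum_univ_succ]

/-- With `B` arbitrary, vanishing of this pairing amounts to `Y₀₀ = ∑ Yᵢᵢ`, the Gram condition
needed for a Cuntz family. -/
theorem sum_comp_signedDiagonal_mul (B : Matrix (Fin p) (Fin p) ℂ)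
    (Y : Matrix (Fin (n + 1) × Fin p) (Fin (n + 1) × Fin p) ℂ) :
    ∑ r, ∑ c, Matrix.comp _ _ _ _ ℂ (signedDiagonal n B) r c * Y r c =
      ∑ a, ∑ b, B a b * (Y (0, a) (0, b) - ∑ i : Fin n, Y (i.succ, a) (i.succ, b)) := by
  rw [sum_block]
  refine Finset.sum_congr rfl fun a _ => Finset.sum_congr rfl fun b _ => ?_
  simp [signedDiagonal_succ_succ_apply, mul_add, Finset.mul_sum, sub_eq_add_neg]

theorem sum_comp_arrowMatrix_mul (A₀ : Matrix (Fin p) (Fin p) ℂ)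
    (A : Fin n → Matrix (Fin p) (Fin p) ℂ)
    (Y : Matrix (Fin (n + 1) × Fin p) (Fin (n + 1) × Fin p) ℂ) :
    ∑ r, ∑ c, Matrix.comp _ _ _ _ ℂ (arrowMatrix A₀ A) r c * Y r c =
      ∑ a, ∑ b, (A₀ a b * (Y (0, a) (0, b) + ∑ i : Fin n, Y (i.succ, a) (i.succ, b))
        + ∑ i, 2 * (A i a b * Y (i.succ, a) (0, b))
        + ∑ i, 2 * (star (A i b a) * Y (0, a) (i.succ, b))) := by
  rw [sum_block]
  refine Finset.sum_congr rfl fun a _ => Finset.sum_congr rfl fun b _ => ?_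
  simp only [Matrix.comp_apply, arrowMatrix_zero_zero, arrowMatrix_zero_succ,
    arrowMatrix_succ_zero, arrowMatrix_succ_succ_apply, ite_mul, zero_mul, Finset.sum_ite_eq,
    Finset.mem_univ, if_true, Matrix.smul_apply, Matrix.conjTranspose_apply, smul_eq_mul,
    mul_add, Finset.mul_sum, mul_assoc, Finset.sum_add_distrib]
  ring

end BlockMatrices

/-! ### Positivity of matrices over a C⋆-algebra. -/

section CStarMatrixPositivity

variable {𝓐 : Type*} [CStarAlgebra 𝓐] [PartialOrder 𝓐] [StarOrderedRing 𝓐] {p : ℕ}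

theorem CStarMatrix.sum_apply {𝓐 : Type*} [AddCommMonoid 𝓐] {p : ℕ} {ι : Type*} (s : Finset ι) (X : ι → CStarMatrix (Fin p) (Fin p) 𝓐)
    (a b : Fin p) : (∑ i ∈ s, X i) a b = ∑ i ∈ s, X i a b :=
  Matrix.sum_apply a b s X

theorem isSelfAdjoint_of_mem_matrixCone {V : Submodule ℂ 𝓐} {X : CStarMatrix (Fin p) (Fin p) 𝓐}
    (hX : X ∈ matrixCone V p) : IsSelfAdjoint X :=
  IsSelfAdjoint.of_nonneg hX.2

/-- A positive matrix over a C⋆-algebra is a positive form in every representation. -/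
theorem re_sum_inner_nonneg_of_mem_matrixCone {V : Submodule ℂ 𝓐}
    {X : CStarMatrix (Fin p) (Fin p) 𝓐} (hX : X ∈ matrixCone V p)
    {H : Type*} [NormedAddCommGroup H] [InnerProductSpace ℂ H] [CompleteSpace H]
    (π : 𝓐 →⋆ₐ[ℂ] (H →L[ℂ] H)) (x : Fin p → H) :
    0 ≤ (∑ a, ∑ b, inner ℂ (x a) (π (X a b) (x b))).re := by
  -- Positive elements lie in the additive closure of the `star Y * Y`, on which the form is a sum
  -- of squared norms.
  have hcl := StarOrderedRing.nonneg_iff.mp hX.2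
  clear hX
  induction hcl using AddSubmonoid.closure_induction with
  | zero => simp
  | add X Y _ _ hX hY =>
    simp only [CStarMatrix.add_apply, map_add, add_apply, inner_add_right,
      Finset.sum_add_distrib, Complex.add_re]
    exact add_nonneg hX hY
  | mem X hX =>
  obtain ⟨Y, rfl⟩ := hX
  have h : ∑ a, ∑ b, inner ℂ (x a) (π ((star Y * Y) a b) (x b)) =
      ∑ c, inner ℂ (∑ a, π (Y c a) (x a)) (∑ b, π (Y c b) (x b)) := by
    simp only [sum_inner, inner_sum, CStarMatrix.mul_apply, CStarMatrix.star_apply, map_sum,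
      map_mul, map_star, sum_apply, mul_apply_eq_comp]
    simp only [ContinuousLinearMap.star_eq_adjoint, ContinuousLinearMap.adjoint_inner_right]
    rw [Finset.sum_congr rfl fun a _ => Finset.sum_comm, Finset.sum_comm]
    exact Finset.sum_congr rfl fun c _ => Finset.sum_comm
  rw [h, Complex.re_sum]
  exact Finset.sum_nonneg fun c _ => inner_self_nonneg (𝕜 := ℂ)

/-- Compressing a positive semidefinite block matrix by a column over a C⋆-algebra gives a
positive matrix. -/
theorem mem_matrixCone_of_posSemidef {V : Submodule ℂ 𝓐} {ι : Type*} [Fintype ι]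
    {M : Matrix (ι × Fin p) (ι × Fin p) ℂ} (hM : M.PosSemidef) (r : ι → 𝓐)
    {X : CStarMatrix (Fin p) (Fin p) 𝓐} (hXV : ∀ a b, X a b ∈ V)
    (hX : ∀ a b, X a b = ∑ t, ∑ u, M (t, a) (u, b) • (star (r t) * r u)) :
    X ∈ matrixCone V p := by
  refine ⟨hXV, ?_⟩
  classical
  obtain ⟨Z, rfl⟩ : ∃ Z : Matrix (ι × Fin p) (ι × Fin p) ℂ, M = Zᴴ * Z := by
    open scoped MatrixOrder in
    exact CStarAlgebra.nonneg_iff_eq_star_mul_self.mp hM.nonneg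
  -- `W s` is the `s`-th block row of `Z` applied to the column `r`, so the compression of `Zᴴ * Z`
  -- is `∑ s, star (W s) * W s`.
  let W : ι → CStarMatrix (Fin p) (Fin p) 𝓐 := fun s =>
    CStarMatrix.ofMatrix (Matrix.of fun c b => ∑ t, Z (s, c) (t, b) • r t)
  have hW : ∀ s c b, W s c b = ∑ t, Z (s, c) (t, b) • r t := fun _ _ _ => rfl
  have hXW : X = ∑ s, star (W s) * W s := by
    ext a b
    rw [hX]
    rw [CStarMatrix.sum_apply]
    simp only [CStarMatrix.mul_apply, CStarMatrix.star_apply, hW, star_sum, star_smul,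
      Finset.sum_mul_sum, smul_mul_smul_comm, Matrix.mul_apply, Matrix.conjTranspose_apply,
      Finset.sum_smul]
    rw [← Fintype.sum_prod_type' (fun s c => ∑ t, ∑ u,
      (star (Z (s, c) (t, a)) * Z (s, c) (u, b)) • (star (r t) * r u))]
    rw [Finset.sum_congr rfl fun t _ => Finset.sum_comm, Finset.sum_comm]
  rw [hXW]
  exact Finset.sum_nonneg fun s _ => star_mul_self_nonneg _

end CStarMatrixPositivity

/-! ### The two implications for the pencil. -/

section CuntzPencil

variable {n p : ℕ}

/-- The matrix `A₀ ⊗ 1 + ∑ Aᵢ ⊗ Sᵢ + ∑ Aᵢᴴ ⊗ Sᵢ⋆`. -/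
noncomputable def cuntzPencil (A₀ : Matrix (Fin p) (Fin p) ℂ)
    (A : Fin n → Matrix (Fin p) (Fin p) ℂ) : CStarMatrix (Fin p) (Fin p) (CuntzAlgebra n) :=
  matTensor A₀ (1 : CuntzAlgebra n) + ∑ i, matTensor (A i) (CuntzAlgebra.S i)
    + ∑ i, matTensor (A i)ᴴ (star (CuntzAlgebra.S i))

theorem cuntzPencil_apply (A₀ : Matrix (Fin p) (Fin p) ℂ)
    (A : Fin n → Matrix (Fin p) (Fin p) ℂ) (a b : Fin p) :
    cuntzPencil A₀ A a b = A₀ a b • (1 : CuntzAlgebra n) + ∑ i, A i a b • CuntzAlgebra.S i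
      + ∑ i, star (A i b a) • star (CuntzAlgebra.S i) := by
  rw [cuntzPencil, CStarMatrix.add_apply, CStarMatrix.add_apply, CStarMatrix.sum_apply,
    CStarMatrix.sum_apply]
  rfl

theorem cuntzPencil_apply_mem (A₀ : Matrix (Fin p) (Fin p) ℂ)
    (A : Fin n → Matrix (Fin p) (Fin p) ℂ) (a b : Fin p) :
    cuntzPencil A₀ A a b ∈ cuntzSystem n := by
  rw [cuntzPencil_apply]
  refine Submodule.add_mem _ (Submodule.add_mem _ (Submodule.smul_mem _ _ ?_)
    (Submodule.sum_mem _ fun i _ => Submodule.smul_mem _ _ ?_))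
    (Submodule.sum_mem _ fun i _ => Submodule.smul_mem _ _ ?_)
  · exact Submodule.subset_span (Or.inl (Or.inl rfl))
  · exact Submodule.subset_span (Or.inl (Or.inr ⟨i, rfl⟩))
  · exact Submodule.subset_span (Or.inr ⟨i, rfl⟩)

/-- Empty Gram data already produce a Cuntz family on `ℓ²`, hence a unital map to a nonzero algebra.
-/
theorem CuntzAlgebra.nontrivial (hn : 1 ≤ n) : Nontrivial (CuntzAlgebra n) := by
  obtain ⟨T, hT, -⟩ := exists_isCuntzFamily_of_inner hn (α := Empty) (fun _ => 0)
    (fun _ _ => 0) (fun a => a.elim)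
  obtain ⟨π, -⟩ := CuntzAlgebra.exists_starAlgHom T hT
  have : Nontrivial EllTwo := by
    by_contra h
    have := not_nontrivial_iff_subsingleton.mp h
    exact EllTwo.not_finiteDimensional inferInstance
  exact π.toRingHom.domain_nontrivial

/-- The adjoint exchanges the `Sᵢ` and `Sᵢ⋆` sums, which therefore cancel identically. Only `1 ≠ 0`
is needed, not linear independence of the generators. -/
theorem isHermitian_of_isSelfAdjoint_cuntzPencil (hn : 1 ≤ n) {A₀ : Matrix (Fin p) (Fin p) ℂ}
    {A : Fin n → Matrix (Fin p) (Fin p) ℂ} (h : IsSelfAdjoint (cuntzPencil A₀ A)) :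
    A₀.IsHermitian := by
  have := CuntzAlgebra.nontrivial hn
  ext a b
  have hab := CStarMatrix.star_apply_of_isSelfAdjoint h (i := b) (j := a)
  rw [cuntzPencil_apply, cuntzPencil_apply] at hab
  simp only [star_add, star_sum, star_smul, star_star, star_one] at hab
  rw [add_right_comm, add_left_inj, add_left_inj] at hab
  exact smul_left_injective ℂ (one_ne_zero (α := CuntzAlgebra n)) hab

theorem cuntzPencil_mem_matrixCone {A₀ B : Matrix (Fin p) (Fin p) ℂ}
    {A : Fin n → Matrix (Fin p) (Fin p) ℂ}
    (hB : BlockPosSemidef (arrowMatrix A₀ A + signedDiagonal n B)) :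
    cuntzPencil A₀ A ∈ matrixCone (cuntzSystem n) p := by
  have hhalf : ((1 / 2 : ℝ) • Matrix.comp _ _ _ _ ℂ
      (arrowMatrix A₀ A + signedDiagonal n B)).PosSemidef :=
    Matrix.PosSemidef.smul hB (by norm_num)
  refine mem_matrixCone_of_posSemidef hhalf
    (Fin.cases 1 (fun i => star (CuntzAlgebra.S i))) (cuntzPencil_apply_mem A₀ A) fun a b => ?_
  have hS := (CuntzAlgebra.isCuntzFamily_S n).sum_range
  have hdiag : ∑ i : Fin n, ((1 / 2 : ℝ) • (A₀ a b - B a b)) •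
      (CuntzAlgebra.S i * star (CuntzAlgebra.S i)) =
      ((1 / 2 : ℝ) • (A₀ a b - B a b)) • (1 : CuntzAlgebra n) := by
    rw [← Finset.smul_sum, hS]
  simp only [Fin.sum_univ_succ, Fin.cases_zero, Fin.cases_succ, Matrix.smul_apply,
    Matrix.comp_apply, Matrix.add_apply, arrowMatrix_zero_zero, arrowMatrix_zero_succ,
    arrowMatrix_succ_zero, arrowMatrix_succ_succ_apply, signedDiagonal_zero_zero,
    signedDiagonal_zero_succ, signedDiagonal_succ_zero, signedDiagonal_succ_succ_apply,
    star_one, star_star, one_mul, mul_one]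
  have hif : ∀ i : Fin n, ∑ j : Fin n, ((1 / 2 : ℝ) • ((if i = j then A₀ a b else 0) +
      (if i = j then -B a b else 0))) • (CuntzAlgebra.S i * star (CuntzAlgebra.S j)) =
      ((1 / 2 : ℝ) • (A₀ a b - B a b)) • (CuntzAlgebra.S i * star (CuntzAlgebra.S i)) := by
    intro i
    rw [Finset.sum_eq_single i (fun j _ hj => by simp [hj.symm]) (by simp)]
    simp [sub_eq_add_neg]
  simp only [hif, Finset.sum_add_distrib, hdiag, cuntzPencil_apply]
  have hc : ∀ c : ℂ, (1 / 2 : ℝ) • ((2 : ℂ) • c + 0) = c := by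
    intro c
    simp
  have h0 : A₀ a b • (1 : CuntzAlgebra n) = ((1 / 2 : ℝ) • (A₀ a b + B a b)) • 1 +
      ((1 / 2 : ℝ) • (A₀ a b - B a b)) • 1 := by
    rw [← add_smul]
    congr 1
    simp only [Complex.real_smul]
    push_cast
    ring
  simp only [Matrix.zero_apply, hc, Matrix.conjTranspose_apply]
  rw [h0]
  abel

theorem exists_blockPosSemidef_of_cuntzPencil_mem (hn : 1 ≤ n)
    {A₀ : Matrix (Fin p) (Fin p) ℂ} {A : Fin n → Matrix (Fin p) (Fin p) ℂ}
    (hX : cuntzPencil A₀ A ∈ matrixCone (cuntzSystem n) p) :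
    ∃ B : Matrix (Fin p) (Fin p) ℂ, BlockPosSemidef (arrowMatrix A₀ A + signedDiagonal n B) := by
  by_contra hB
  have hA₀ := isHermitian_of_isSelfAdjoint_cuntzPencil hn (isSelfAdjoint_of_mem_matrixCone hX)
  obtain ⟨Y, hY, hYN, hYM⟩ := Matrix.exists_posSemidef_sum_mul_lt_zero
    (signedDiagonalSubmodule n p)
    (by rintro _ ⟨B, rfl⟩; exact ⟨Bᴴ, (conjTranspose_comp_signedDiagonal B).symm⟩)
    -- Weight `n` on block `0` balances the `n` blocks `-B`; it is positive because `1 ≤ n`.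
    (fun r => Fin.cases (n : ℝ) (fun _ => 1) r.1)
    (by
      rintro ⟨r, a⟩
      refine Fin.cases ?_ (fun i => ?_) r
      · exact Nat.cast_pos.mpr hn
      · exact one_pos)
    (by
      rintro _ ⟨B, rfl⟩
      rw [Fintype.sum_prod_type_right]
      refine Finset.sum_eq_zero fun a _ => ?_
      simp [Fin.sum_univ_succ, signedDiagonal_succ_succ_apply])
    (isHermitian_comp_arrowMatrix hA₀ A)
    (by
      rintro ⟨_, ⟨B, rfl⟩, h⟩
      exact hB ⟨B, h⟩)
  obtain ⟨z, hz⟩ := hY.exists_inner_ellTwo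
  have hYdiag : ∀ a b, Y (0, a) (0, b) = ∑ i : Fin n, Y (i.succ, a) (i.succ, b) := by
    intro a b
    have h := hYN _ ⟨Matrix.single a b 1, rfl⟩
    rw [sum_comp_signedDiagonal_mul, Finset.sum_eq_single a
      (fun a' _ h => Finset.sum_eq_zero fun b' _ => by simp [h.symm])
      (by simp), Finset.sum_eq_single b
      (fun b' _ h => by simp [h.symm]) (by simp)] at h
    rw [Matrix.single_apply_same, one_mul, sub_eq_zero] at h
    exact h
  obtain ⟨T, hT, hTz⟩ := exists_isCuntzFamily_of_inner hn (fun a => z (0, a))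
    (fun i a => z (i.succ, a)) (fun a b => by simp only [hz, hYdiag])
  obtain ⟨π, hπ⟩ := CuntzAlgebra.exists_starAlgHom T hT
  have hpos := re_sum_inner_nonneg_of_mem_matrixCone hX π (fun a => z (0, a))
  have hT1 : ∀ i a b, inner ℂ (z (0, a)) (T i (z (0, b))) = Y (i.succ, a) (0, b) := by
    intro i a b
    rw [← hz, ← hTz, ContinuousLinearMap.star_eq_adjoint, ContinuousLinearMap.adjoint_inner_left]
  have hT2 : ∀ i a b, inner ℂ (z (0, a)) ((star (T i)) (z (0, b))) = Y (0, a) (i.succ, b) := by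
    intro i a b
    rw [hTz, hz]
  have hval : ∀ a b, inner ℂ (z (0, a)) (π (cuntzPencil A₀ A a b) (z (0, b))) =
      A₀ a b * Y (0, a) (0, b) + ∑ i, A i a b * Y (i.succ, a) (0, b)
        + ∑ i, star (A i b a) * Y (0, a) (i.succ, b) := by
    intro a b
    rw [cuntzPencil_apply]
    simp only [map_add, map_sum, map_smul, map_star, map_one, hπ, add_apply, sum_apply, smul_apply,
      one_apply_eq_self, inner_add_right, inner_sum, inner_smul_right, hT1, hT2, hz]
  -- The factor `2` comes from `Y₀₀ + ∑ Yᵢᵢ = 2 Y₀₀` in the `A₀` terms and from the doubled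
  -- off-diagonal blocks in the others.
  have hdouble : ∑ r, ∑ c, Matrix.comp _ _ _ _ ℂ (arrowMatrix A₀ A) r c * Y r c =
      2 * ∑ a, ∑ b, inner ℂ (z (0, a)) (π (cuntzPencil A₀ A a b) (z (0, b))) := by
    rw [sum_comp_arrowMatrix_mul, Finset.mul_sum]
    refine Finset.sum_congr rfl fun a _ => ?_
    rw [Finset.mul_sum]
    refine Finset.sum_congr rfl fun b _ => ?_
    rw [hval, ← hYdiag, ← Finset.mul_sum, ← Finset.mul_sum]
    ring
  rw [hdouble, Complex.mul_re] at hYM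
  norm_num at hYM
  rw [Complex.re_sum] at hpos
  simp only [Complex.re_sum] at hYM hpos
  linarith

end CuntzPencil

theorem mainTheorem2 (n : ℕ) (hn : 1 ≤ n) (p : ℕ) (A₀ : Matrix (Fin p) (Fin p) ℂ)
    (A : Fin n → Matrix (Fin p) (Fin p) ℂ) :
    matTensor A₀ (1 : CuntzAlgebra n) + ∑ i, matTensor (A i) (CuntzAlgebra.S i)
        + ∑ i, matTensor (A i)ᴴ (star (CuntzAlgebra.S i)) ∈ matrixCone (cuntzSystem n) p ↔
      ∃ B : Matrix (Fin p) (Fin p) ℂ, BlockPosSemidef (arrowMatrix A₀ A + signedDiagonal n B) :=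
  ⟨fun h => exists_blockPosSemidef_of_cuntzPencil_mem hn h,
    fun ⟨_, hB⟩ => cuntzPencil_mem_matrixCone hB⟩
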